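/- Let $Q$ be a real symmetric $n\times n$ matrix and $c\in\mathbb{R}^n$. **(1)** Let $A\in\mathbb{R}^{m\times n}$ with rows $A_1,\dots,A_m$, let $b\in\mathbb{R}^m$, and suppose that $P=\{x\in\mathbb{R}^n : Ax\le b\}$ is nonempty and bounded. Consider the following lower bound for $\min\{x^TQx+2c^Tx : x\in P\}$: $$\text{(L)}\quad \sup\ \ell\quad\text{s.t.}\quad x^TQx+2c^Tx-\ell+\sum_{i=1}^m\alpha_i(x)(A_ix-b_i)\ge 0\ \ \text{for all } x\in\mathbb{R}^n,$$ over $\ell\in\mathbb{R}$ and affine functions $\alpha_1,\dots,\alpha_m$ on $\mathbb{R}^n$ that are nonnegative on $P$. Then: (a) A number $\ell$ is feasible for (L), with some $\alpha_i$, if and only if it is feasible, with some $Y,y$, for the semidefinite program $$\text{(L}_0\text{)}\quad \sup\ \ell\quad\text{s.t.}\quad \begin{pmatrix}-A^TYA & A^T(Yb+\tfrac12y)\\ (Yb+\tfrac12y)^TA & -y^Tb-b^TYb\end{pmatrix}+\begin{pmatrix}Q&c\\c^T&-\ell\end{pmatrix}\succeq0,\quad Y=Y^T\ge0,\ y\ge0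 .$$ (b) The conic dual of (L$_0$), with respect to the inner product $M\bullet N=\operatorname{trace}(MN^T)$ on symmetric matrices, is the problem $$\text{(DD0)}\quad \inf\ Q\bullet X+2c^Tx\quad\text{s.t.}\quad AXA^T-b\,x^TA^T-Ax\,b^T\ge -bb^T,\quad Ax\le b,\quad X\succeq xx^T .$$ That is, the feasible points of the dual are exactly the matrices $\begin{pmatrix}X&x\\x^T&1\end{pmatrix}$ with $(x,X)$ feasible for (DD0), and the dual objective at this matrix is $Q\bullet X+2c^Tx$. (c) (DD0) is a relaxation of the quadratic program: if $x\in P$, then $(x,xx^T)$ is feasible for (DD0), with objective value $x^TQx+2c^Tx$. (d) The optimal values of (L) and (DD0) are finite and equal. **(2)** Let a box-constrained program $\min\{x^TQx+2c^Tx : a_i^Tx=d_i\ (i=1,\dots,k),\ l\le x\le u\}$ have a nonempty feasible set, and write its constraints as the system $x\le u$, $-x\le -l$, $a_i^Tx\le d_i$, $-a_i^Tx\le -d_i$. For this system, the feasible set of (DD0) is that of the Shor relaxation with partial first-level RLT, $$\text{(SRLT)}\quad\begin{aligned}\inf\ & Q\bullet X+2c^Tx\\ \text{s.t.}\ & Xa_i=d_ix,\quad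 a_i^Tx=d_i\quad(i=1,\dots,k),\\ & X-lx^T-xl^T+ll^T\ge0,\quad ux^T-X-ul^T+xl^T\ge0,\quad X-ux^T-xu^T+uu^T\ge0,\\ & X-xx^T\succeq0,\end{aligned}$$ where $X$ is symmetric (for $l=0$, $u=e$, the all-ones vector, the second line of constraints reads $X\ge0$, $ex^T-X\ge0$, $X-ex^T-xe^T+ee^T\ge0$). Hence (SRLT) is the conic dual of (L$_0$) in this case, and the optimal values of (L) and (SRLT) are finite and equal. Here $\ge$ between matrices or vectors is entrywise, and $M\succeq N$ means that $M-N$ is symmetric positive semidefinite. -/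

import Mathlib

open Matrix

noncomputable section

/-! ### Conic programs and their duals -/

/-- The conic program `max obj v` subject to `v ∈ K`, `off + map v ∈ C`, with `K`, `C` convex
cones. -/
structure ConicProgram (E F : Type*) [AddCommGroup E] [Module ℝ E] [AddCommGroup F]
    [Module ℝ F] where
  obj : E →ₗ[ℝ] ℝ
  K : PointedCone ℝ E
  map : E →ₗ[ℝ] F
  off : F
  C : PointedCone ℝ F

namespace ConicProgram

variable {E F : Type*} [AddCommGroup E] [Module ℝ E] [AddCommGroup F] [Module ℝ F]

/-- Feasibility in `max obj v` s.t. `v ∈ K`, `off + map v ∈ C`. -/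
def Feasible (P : ConicProgram E F) (v : E) : Prop :=
  v ∈ P.K ∧ P.off + P.map v ∈ P.C

/-- Feasibility in the conic dual `min ⟨off, z⟩` s.t. `z ∈ C*`, `-(obj + map* z) ∈ K*`, where the
constraint space is paired with itself by `B`. -/
def DualFeasible (P : ConicProgram E F) (B : F →ₗ[ℝ] F →ₗ[ℝ] ℝ) (z : F) : Prop :=
  z ∈ PointedCone.dual B (P.C : Set F) ∧ ∀ v ∈ P.K, 0 ≤ -(P.obj v + B (P.map v) z)

/-- Objective function of the conic dual. -/
def dualObj (P : ConicProgram E F) (B : F →ₗ[ℝ] F →ₗ[ℝ] ℝ) (z : F) : ℝ :=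
  B P.off z

end ConicProgram

/-! ### Symmetric matrices -/

/-- The space of real symmetric matrices. -/
def symMatrix (N : Type*) : Submodule ℝ (Matrix N N ℝ) where
  carrier := {M | M.IsSymm}
  add_mem' h₁ h₂ := IsSymm.add h₁ h₂
  zero_mem' := isSymm_zero
  smul_mem' r _ h := IsSymm.smul h r

/-- The cone of positive semidefinite matrices in the space of symmetric matrices. -/
def psdCone (N : Type*) : PointedCone ℝ (symMatrix N) where
  carrier := {M | (M : Matrix N N ℝ).PosSemidef}
  add_mem' h₁ h₂ := PosSemidef.add h₁ h₂
  zero_mem' := PosSemidef.zero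
  smul_mem' r _ h := PosSemidef.smul h r.2

/-- The inner product `M • N = trace (M Nᵀ)` on symmetric matrices. -/
def symPairing (N : Type*) [Fintype N] : symMatrix N →ₗ[ℝ] symMatrix N →ₗ[ℝ] ℝ :=
  LinearMap.mk₂ ℝ (fun M M' => trace ((M : Matrix N N ℝ) * (M' : Matrix N N ℝ)ᵀ))
    (fun _ _ _ => by simp [add_mul]) (fun _ _ _ => by simp)
    (fun _ _ _ => by simp [mul_add]) (fun _ _ _ => by simp)

/-- The block matrix `[M, v; vᵀ, t]`. -/
def bordered {κ : Type*} (M : Matrix κ κ ℝ) (v : κ → ℝ) (t : ℝ) :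
    Matrix (κ ⊕ Unit) (κ ⊕ Unit) ℝ :=
  fromBlocks M (replicateCol Unit v) (replicateRow Unit v) (of fun _ _ => t)

theorem bordered_isSymm {κ : Type*} {M : Matrix κ κ ℝ} (hM : M.IsSymm) (v : κ → ℝ) (t : ℝ) :
    (bordered M v t).IsSymm := by
  refine IsSymm.fromBlocks hM ?_ ?_
  · ext i j; rfl
  · ext i j; rfl

/-! ### The quadratic program and the bound with affine multipliers -/

section QP

variable {ι κ : Type*} [Fintype ι] [Fintype κ]

/-- The polyhedron `{x | A x ≤ b}`. -/
def polyhedron {ι κ : Type*} [Fintype κ] (A : Matrix ι κ ℝ) (b : ι → ℝ) : Set (κ → ℝ) := {x | A *ᵥ x ≤ b}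

/-- The quadratic function `xᵀ Q x + 2 cᵀ x`. -/
def quadFun {κ : Type*} [Fintype κ] (Q : Matrix κ κ ℝ) (c : κ → ℝ) (x : κ → ℝ) : ℝ := x ⬝ᵥ Q *ᵥ x + 2 * (c ⬝ᵥ x)

/-- `(ℓ, α)` is feasible for the bound: the affine functions `α i` are nonnegative on the
polyhedron, and the polynomial `xᵀ Q x + 2 cᵀ x - ℓ + ∑ i, α i (x) (A_i x - b_i)` is nonnegative
on the whole space. -/
def BoundFeasible (A : Matrix ι κ ℝ) (b : ι → ℝ) (Q : Matrix κ κ ℝ) (c : κ → ℝ) (ℓ : ℝ)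
    (α : ι → (κ → ℝ) →ᵃ[ℝ] ℝ) : Prop :=
  (∀ x, 0 ≤ quadFun Q c x - ℓ + ∑ i, α i x * ((A *ᵥ x) i - b i)) ∧
    ∀ i, ∀ x ∈ polyhedron A b, 0 ≤ α i x

/-- Optimal value of the bound: the supremum of all feasible `ℓ`. -/
def boundValue (A : Matrix ι κ ℝ) (b : ι → ℝ) (Q : Matrix κ κ ℝ) (c : κ → ℝ) : EReal :=
  ⨆ (ℓ : ℝ) (α : ι → (κ → ℝ) →ᵃ[ℝ] ℝ) (_ : BoundFeasible A b Q c ℓ α), (ℓ : EReal)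

/-! ### The bound as a semidefinite program -/

/-- The linear map sending `(Y, y, ℓ)` to
`[-Aᵀ Y A, Aᵀ (Y b + y / 2); (Y b + y / 2)ᵀ A, -yᵀ b - bᵀ Y b - ℓ]`. -/
def boundMap (A : Matrix ι κ ℝ) (b : ι → ℝ) :
    symMatrix ι × (ι → ℝ) × ℝ →ₗ[ℝ] symMatrix (κ ⊕ Unit) where
  toFun v := ⟨bordered (-(Aᵀ * (v.1 : Matrix ι ι ℝ) * A))
      (Aᵀ *ᵥ ((v.1 : Matrix ι ι ℝ) *ᵥ b + (1 / 2 : ℝ) • v.2.1))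
      (-(v.2.1 ⬝ᵥ b) - b ⬝ᵥ (v.1 : Matrix ι ι ℝ) *ᵥ b - v.2.2),
    bordered_isSymm (by
      have h : (v.1 : Matrix ι ι ℝ)ᵀ = v.1 := v.1.2
      simp [IsSymm, transpose_mul, h, Matrix.mul_assoc]) _ _⟩
  map_add' v w := by
    apply Subtype.ext
    ext (i | i) (j | j) <;>
      simp [bordered, Matrix.mul_add, Matrix.add_mul, add_mulVec, mulVec_add, smul_add] <;> ring
  map_smul' r v := by
    apply Subtype.ext
    ext (i | i) (j | j) <;>
      simp [bordered, smul_mulVec, mulVec_smul, mulVec_add] <;> ring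

/-- The cone of all `(Y, y, ℓ)` with `Y` symmetric, `Y ≥ 0` and `y ≥ 0` entrywise, `ℓ` free. -/
def boundCone (ι : Type*) : PointedCone ℝ (symMatrix ι × (ι → ℝ) × ℝ) where
  carrier := {v | (∀ i j, 0 ≤ (v.1 : Matrix ι ι ℝ) i j) ∧ ∀ i, 0 ≤ v.2.1 i}
  add_mem' h₁ h₂ := ⟨fun i j => add_nonneg (h₁.1 i j) (h₂.1 i j),
    fun i => add_nonneg (h₁.2 i) (h₂.2 i)⟩
  zero_mem' := ⟨fun _ _ => le_rfl, fun _ => le_rfl⟩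
  smul_mem' r _ h := ⟨fun i j => mul_nonneg r.2 (h.1 i j), fun i => mul_nonneg r.2 (h.2 i)⟩

/-- The bound as a semidefinite program: `max ℓ` s.t.
`[-Aᵀ Y A, Aᵀ (Y b + y / 2); (Y b + y / 2)ᵀ A, -yᵀ b - bᵀ Y b] + [Q, c; cᵀ, -ℓ] ⪰ 0`,
`Y ≥ 0`, `y ≥ 0`, `Yᵀ = Y`. -/
def boundSDP (A : Matrix ι κ ℝ) (b : ι → ℝ) (Q : Matrix κ κ ℝ) (hQ : Q.IsSymm) (c : κ → ℝ) :
    ConicProgram (symMatrix ι × (ι → ℝ) × ℝ) (symMatrix (κ ⊕ Unit)) where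
  obj := LinearMap.snd ℝ (ι → ℝ) ℝ ∘ₗ LinearMap.snd ℝ (symMatrix ι) ((ι → ℝ) × ℝ)
  K := boundCone ι
  map := boundMap A b
  off := ⟨bordered Q c 0, bordered_isSymm hQ c 0⟩
  C := psdCone (κ ⊕ Unit)

/-! ### The semidefinite relaxation -/

/-- The objective `Q • X + 2 cᵀ x`, where `Q • X = trace (Q Xᵀ)`. -/
def relaxObj {κ : Type*} [Fintype κ] (Q : Matrix κ κ ℝ) (c : κ → ℝ) (x : κ → ℝ) (X : Matrix κ κ ℝ) : ℝ :=
  trace (Q * Xᵀ) + 2 * (c ⬝ᵥ x)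

/-- Feasibility in the semidefinite relaxation:
`A X Aᵀ - b xᵀ Aᵀ - A x bᵀ ≥ -b bᵀ` entrywise, `A x ≤ b`, `X ⪰ x xᵀ`. -/
def RelaxFeasible (A : Matrix ι κ ℝ) (b : ι → ℝ) (x : κ → ℝ) (X : Matrix κ κ ℝ) : Prop :=
  (∀ i j, (-vecMulVec b b) i j ≤
    (A * X * Aᵀ - vecMulVec b (A *ᵥ x) - vecMulVec (A *ᵥ x) b) i j) ∧
  A *ᵥ x ≤ b ∧ (X - vecMulVec x x).PosSemidef

/-- Optimal value of the semidefinite relaxation. -/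
def relaxValue (A : Matrix ι κ ℝ) (b : ι → ℝ) (Q : Matrix κ κ ℝ) (c : κ → ℝ) : EReal :=
  ⨅ (x : κ → ℝ) (X : Matrix κ κ ℝ) (_ : RelaxFeasible A b x X), (relaxObj Q c x X : EReal)

end QP

/-! ### Box-constrained programs -/

section Box

variable {ι κ : Type*} [Fintype κ]

/-- The feasible set `{x | a x = d, l ≤ x ≤ u}` of a box-constrained program. -/
def boxSet (a : Matrix ι κ ℝ) (d : ι → ℝ) (l u : κ → ℝ) : Set (κ → ℝ) :=
  {x | a *ᵥ x = d ∧ l ≤ x ∧ x ≤ u}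

/-- Coefficients of the system `x ≤ u`, `-x ≤ -l`, `a x ≤ d`, `-a x ≤ -d`. -/
def boxMatrix [DecidableEq κ] (a : Matrix ι κ ℝ) : Matrix ((κ ⊕ κ) ⊕ (ι ⊕ ι)) κ ℝ :=
  fromRows (fromRows 1 (-1)) (fromRows a (-a))

/-- Right-hand sides of the system `x ≤ u`, `-x ≤ -l`, `a x ≤ d`, `-a x ≤ -d`. -/
def boxRhs (d : ι → ℝ) (l u : κ → ℝ) : (κ ⊕ κ) ⊕ (ι ⊕ ι) → ℝ :=
  Sum.elim (Sum.elim u (-l)) (Sum.elim d (-d))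

theorem polyhedron_box [DecidableEq κ] (a : Matrix ι κ ℝ) (d : ι → ℝ) (l u : κ → ℝ) :
    polyhedron (boxMatrix a) (boxRhs d l u) = boxSet a d l u := by
  ext x
  simp only [polyhedron, boxSet, boxMatrix, boxRhs, Set.mem_ofPred_eq, fromRows_mulVec,
    Sum.elim_le_elim_iff, one_mulVec, neg_mulVec, neg_le_neg_iff, le_antisymm_iff]
  tauto

/-- Feasibility in the Shor relaxation with partial first-level RLT: `X a_iᵀ = d_i x`, `a x = d`,
the products `(x - l)(x - l)ᵀ`, `(u - x)(x - l)ᵀ`, `(u - x)(u - x)ᵀ`, linearized by replacing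
`x xᵀ` with `X`, are entrywise nonnegative, and `X - x xᵀ ⪰ 0`. -/
def SRLTFeasible (a : Matrix ι κ ℝ) (d : ι → ℝ) (l u : κ → ℝ) (x : κ → ℝ)
    (X : Matrix κ κ ℝ) : Prop :=
  (∀ i, X *ᵥ a i = d i • x) ∧ a *ᵥ x = d ∧
  (∀ j k, 0 ≤ (X - vecMulVec l x - vecMulVec x l + vecMulVec l l) j k) ∧
  (∀ j k, 0 ≤ (vecMulVec u x - X - vecMulVec u l + vecMulVec x l) j k) ∧
  (∀ j k, 0 ≤ (X - vecMulVec u x - vecMulVec x u + vecMulVec u u) j k) ∧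
  (X - vecMulVec x x).PosSemidef

/-- On the box `0 ≤ x ≤ e` the three RLT constraints read `X ≥ 0`, `e xᵀ - X ≥ 0` and
`X - e xᵀ - x eᵀ + e eᵀ ≥ 0`. -/
theorem srltFeasible_unitBox (a : Matrix ι κ ℝ) (d : ι → ℝ) (x : κ → ℝ) (X : Matrix κ κ ℝ) :
    SRLTFeasible a d 0 1 x X ↔
      (∀ i, X *ᵥ a i = d i • x) ∧ a *ᵥ x = d ∧
      (∀ j k, 0 ≤ X j k) ∧
      (∀ j k, 0 ≤ (vecMulVec (1 : κ → ℝ) x - X) j k) ∧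
      (∀ j k, 0 ≤ (X - vecMulVec (1 : κ → ℝ) x - vecMulVec x (1 : κ → ℝ) +
        vecMulVec (1 : κ → ℝ) (1 : κ → ℝ)) j k) ∧
      (X - vecMulVec x x).PosSemidef := by
  simp [SRLTFeasible]

/-- Optimal value of the Shor relaxation with partial first-level RLT. -/
def srltValue (a : Matrix ι κ ℝ) (d : ι → ℝ) (l u : κ → ℝ) (Q : Matrix κ κ ℝ) (c : κ → ℝ) :
    EReal :=
  ⨅ (x : κ → ℝ) (X : Matrix κ κ ℝ) (_ : SRLTFeasible a d l u x X), (relaxObj Q c x X : EReal)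

end Box

end

/-! ### Self-duality of the positive semidefinite cone -/

section PosSemidef

/-! Put s = b - Ax. By Farkas' lemma, the affine functions nonnegative on P are exactly y_i + ∑_j
Y_ij s_j with nonnegative coefficients. So (L) asks that xᵀQx + 2cᵀx - ℓ - sᵀYs - yᵀs be nonnegative
everywhere. Only the symmetric part of Y matters here, and a quadratic polynomial is nonnegative
everywhere iff its bordered matrix is positive semidefinite: this is (L₀).

The dual is read off from the adjoint formula `symPairing_boundMap`. Against [X, x; xᵀ, t], the free
variable ℓ forces t = 1, the signs of Y and y give the linear constraints, and self-duality of the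
cone with a Schur complement gives X ⪰ xxᵀ.

Strong duality uses boundedness of P instead of a Slater point. If ℓ is infeasible for (L₀),
`exists_posSemidef_separating` yields a nonzero semidefinite Z with corner t. A zero corner would
make Z a recession direction of (DD0), and these vanish over a polytope (`corner_pos_of_bounded`).
So t > 0, and Z / t is feasible for (DD0) with value at most ℓ. The same separation with ℓ left free
shows that (L₀) is feasible; a point of P makes (DD0) feasible, so the common value is finite.

For a box, the entries of the matrix inequality are the RLT products. Opposite rows ±a_i turn
inequalities into Xa_i = d_i x, and the diagonal RLT constraints give back l ≤ x ≤ u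
(`relaxFeasible_box_iff`). -/

theorem posSemidef_iff_isSymm_and_nonneg {n : Type*} [Fintype n] {M : Matrix n n ℝ} :
    M.PosSemidef ↔ M.IsSymm ∧ ∀ x, 0 ≤ x ⬝ᵥ M *ᵥ x := by
  constructor
  · intro h
    refine ⟨?_, fun x => ?_⟩
    · have := h.isHermitian
      rwa [IsHermitian, conjTranspose_eq_transpose_of_trivial] at this
    · simpa using h.dotProduct_mulVec_nonneg x
  · rintro ⟨h, h'⟩
    refine PosSemidef.of_dotProduct_mulVec_nonneg ?_ fun x => by simpa using h' x
    rwa [IsHermitian, conjTranspose_eq_transpose_of_trivial]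

theorem trace_mul_transpose_vecMulVec {n : Type*} [Fintype n] (M : Matrix n n ℝ) (v : n → ℝ) :
    trace (M * (vecMulVec v v)ᵀ) = v ⬝ᵥ M *ᵥ v := by
  rw [transpose_vecMulVec, mul_vecMulVec, trace_vecMulVec, dotProduct_comm]

theorem trace_mul_transpose_nonneg {n : Type*} [Fintype n] {M N : Matrix n n ℝ}
    (hM : M.PosSemidef) (hN : N.PosSemidef) : 0 ≤ trace (M * Nᵀ) := by
  classical
  obtain ⟨m, v, rfl⟩ := posSemidef_iff_eq_sum_vecMulVec.1 hN
  simp only [star_trivial, transpose_sum, Matrix.mul_sum, trace_sum, trace_mul_transpose_vecMulVec]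
  exact Finset.sum_nonneg fun i _ => (posSemidef_iff_isSymm_and_nonneg.1 hM).2 _

theorem posSemidef_vecMulVec {n : Type*} [Fintype n] (v : n → ℝ) :
    (vecMulVec v v).PosSemidef := by
  simpa using posSemidef_vecMulVec_self_star v

/-- Testing against rank-one matrices xxᵀ recovers the quadratic form of Z; conversely a
semidefinite matrix is a sum of such rank-one matrices. -/
theorem mem_dual_psdCone {n : Type*} [Fintype n] (Z : symMatrix n) :
    Z ∈ PointedCone.dual (symPairing n) (psdCone n : Set (symMatrix n)) ↔
      (Z : Matrix n n ℝ).PosSemidef := by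
  constructor
  · intro h
    refine posSemidef_iff_isSymm_and_nonneg.2 ⟨Z.2, fun x => ?_⟩
    have hx : (⟨vecMulVec x x, (posSemidef_iff_isSymm_and_nonneg.1 (posSemidef_vecMulVec x)).1⟩ :
      symMatrix n) ∈ psdCone n := posSemidef_vecMulVec x
    have := h hx
    change 0 ≤ trace (vecMulVec x x * (Z : Matrix n n ℝ)ᵀ) at this
    rwa [← trace_transpose, transpose_mul, transpose_transpose,
      trace_mul_transpose_vecMulVec] at this
  · intro h M hM
    exact trace_mul_transpose_nonneg hM h

end PosSemidef

/-! ### Bordered matrices and quadratic polynomials -/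

section Bordered

variable {κ : Type*}

theorem exists_eq_bordered {Z : Matrix (κ ⊕ Unit) (κ ⊕ Unit) ℝ} (hZ : Z.IsSymm) :
    ∃ X x t, X.IsSymm ∧ Z = bordered X x t := by
  refine ⟨Z.toBlocks₁₁, fun i => Z (.inl i) (.inr ()), Z (.inr ()) (.inr ()), ?_, ?_⟩
  · ext i j; exact hZ.apply _ _
  · ext (i | i) (j | j)
    · rfl
    · rfl
    · exact hZ.apply _ _
    · rfl

theorem isSymm_of_bordered {X : Matrix κ κ ℝ} {x : κ → ℝ} {t : ℝ}
    (h : (bordered X x t).IsSymm) : X.IsSymm := by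
  ext i j; exact h.apply (.inl i) (.inl j)

theorem forall_sumUnit {p : (κ ⊕ Unit → ℝ) → Prop} :
    (∀ z, p z) ↔ ∀ (x : κ → ℝ) (s : ℝ), p (Sum.elim x fun _ => s) := by
  refine ⟨fun h _ _ => h _, fun h z => ?_⟩
  have : z = Sum.elim (fun i => z (.inl i)) (fun _ => z (.inr ())) := by
    ext (i | i) <;> rfl
  rw [this]; exact h _ _

variable [Fintype κ]

theorem bordered_mulVec (M : Matrix κ κ ℝ) (v x : κ → ℝ) (t s : ℝ) :
    bordered M v t *ᵥ Sum.elim x (fun _ => s) =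
      Sum.elim (M *ᵥ x + s • v) (fun _ => v ⬝ᵥ x + t * s) := by
  ext (i | i) <;> simp [bordered, mulVec, dotProduct, mul_comm]

theorem dotProduct_bordered_mulVec (M : Matrix κ κ ℝ) (v x : κ → ℝ) (t s : ℝ) :
    Sum.elim x (fun _ => s) ⬝ᵥ bordered M v t *ᵥ Sum.elim x (fun _ => s) =
      x ⬝ᵥ M *ᵥ x + 2 * s * (v ⬝ᵥ x) + s ^ 2 * t := by
  rw [bordered_mulVec]
  simp [dotProduct_add, dotProduct_comm x v]
  ring

theorem trace_bordered_mul_transpose (M X : Matrix κ κ ℝ) (v x : κ → ℝ) (t s : ℝ) :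
    trace (bordered M v t * (bordered X x s)ᵀ) = trace (M * Xᵀ) + 2 * (v ⬝ᵥ x) + t * s := by
  simp [bordered, trace, Matrix.mul_apply, dotProduct, Finset.sum_add_distrib]
  ring

/-- Homogenization: a nonzero last coordinate can be scaled to 1; if it is 0, a negative value of
the leading form would send the polynomial to -∞ along a ray. -/
theorem posSemidef_bordered_iff_forall {M : Matrix κ κ ℝ} (hM : M.IsSymm) (v : κ → ℝ) (t : ℝ) :
    (bordered M v t).PosSemidef ↔ ∀ x, 0 ≤ x ⬝ᵥ M *ᵥ x + 2 * (v ⬝ᵥ x) + t := by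
  rw [posSemidef_iff_isSymm_and_nonneg, forall_sumUnit]
  simp only [dotProduct_bordered_mulVec]
  constructor
  · intro h x
    simpa using h.2 x 1
  · refine fun h => ⟨bordered_isSymm hM v t, fun x s => ?_⟩
    rcases eq_or_ne s 0 with rfl | hs
    · by_contra! hneg
      have key : ∀ k : ℝ, 0 ≤ k ^ 2 * (x ⬝ᵥ M *ᵥ x) + 2 * k * (v ⬝ᵥ x) + t := fun k => by
        have := h (k • x)
        simp only [mulVec_smul, dotProduct_smul, smul_dotProduct, smul_eq_mul] at this
        linarith
      have h1 : x ⬝ᵥ M *ᵥ x < 0 := by simpa using hneg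
      set q := x ⬝ᵥ M *ᵥ x
      -- A multiple of x large enough for the negative term k²q to outweigh 2k(v·x) + t.
      have h2 := key ((|v ⬝ᵥ x| * 2 + |t| + 1) / -q + 1)
      set r := (|v ⬝ᵥ x| * 2 + |t| + 1) / -q with hr
      have hr' : r * q = -(|v ⬝ᵥ x| * 2 + |t| + 1) := by
        rw [hr, div_neg, neg_mul, div_mul_cancel₀ _ h1.ne]
      have hr0 : 0 ≤ r := div_nonneg (by positivity) (by linarith)
      have h3 : (r + 1) * (v ⬝ᵥ x) ≤ (r + 1) * |v ⬝ᵥ x| :=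
        mul_le_mul_of_nonneg_left (le_abs_self _) (by linarith)
      have h4 : (r + 1) ^ 2 * q = -(r + 1) * (|v ⬝ᵥ x| * 2 + |t| + 1) + (r + 1) * q := by
        linear_combination (r + 1) * hr'
      have h5 := mul_nonneg hr0 (abs_nonneg t)
      nlinarith [le_abs_self t]
    · have := h (s⁻¹ • x)
      simp only [mulVec_smul, dotProduct_smul, smul_dotProduct, smul_eq_mul] at this
      have h2 := mul_nonneg (sq_nonneg s) this
      refine h2.trans_eq ?_
      field_simp

/-- Schur complement: the form at (y, s) is yᵀ(X - xxᵀ)y + (x·y + s)², minimized over s at s =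
-(x·y). -/
theorem posSemidef_bordered_one_iff {X : Matrix κ κ ℝ} (x : κ → ℝ) :
    (bordered X x 1).PosSemidef ↔ (X - vecMulVec x x).PosSemidef := by
  have key : ∀ y : κ → ℝ, y ⬝ᵥ (X - vecMulVec x x) *ᵥ y = y ⬝ᵥ X *ᵥ y - (x ⬝ᵥ y) ^ 2 := by
    intro y
    rw [sub_mulVec, vecMulVec_mulVec, dotProduct_sub]
    simp [dotProduct_comm y x]
    ring
  constructor
  · intro h
    rw [posSemidef_iff_isSymm_and_nonneg] at h ⊢
    refine ⟨(isSymm_of_bordered h.1).sub (transpose_vecMulVec x x), fun y => ?_⟩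
    have := h.2 (Sum.elim y fun _ => -(x ⬝ᵥ y))
    rw [dotProduct_bordered_mulVec] at this
    rw [key]; linarith
  · intro h
    rw [posSemidef_iff_isSymm_and_nonneg] at h
    have hX : X.IsSymm := by
      have := h.1.add (transpose_vecMulVec x x : (vecMulVec x x).IsSymm)
      rwa [sub_add_cancel] at this
    rw [posSemidef_bordered_iff_forall hX]
    intro y
    have := h.2 y
    rw [key] at this
    nlinarith [sq_nonneg (x ⬝ᵥ y + 1)]

/-- The form vanishes at the last basis vector, which therefore lies in the kernel; its image is the
last column. -/
theorem eq_zero_of_posSemidef_bordered_zero {X : Matrix κ κ ℝ} {x : κ → ℝ}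
    (h : (bordered X x 0).PosSemidef) : x = 0 := by
  have := (h.dotProduct_mulVec_zero_iff (Sum.elim 0 fun _ => 1)).1 (by
    rw [star_trivial, dotProduct_bordered_mulVec]; simp)
  rw [bordered_mulVec] at this
  ext i
  simpa using congrFun this (.inl i)

end Bordered

/-! ### Farkas' lemma and affine functions on a polyhedron -/

section Farkas

/-- Farkas' lemma for linear functionals on a real vector space. -/
theorem exists_nonneg_sum_of_forall_nonneg {E : Type*} [AddCommGroup E] [Module ℝ E] :
    ∀ (m : ℕ) (f : Fin m → E →ₗ[ℝ] ℝ) (g : E →ₗ[ℝ] ℝ),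
      (∀ x, (∀ i, 0 ≤ f i x) → 0 ≤ g x) → ∃ y : Fin m → ℝ, (∀ i, 0 ≤ y i) ∧ g = ∑ i, y i • f i
  | 0, f, g, h => by
    refine ⟨0, fun i => i.elim0, LinearMap.ext fun x => ?_⟩
    have h1 := h x fun i => i.elim0
    have h2 := h (-x) fun i => i.elim0
    rw [map_neg] at h2
    simpa using le_antisymm (by linarith) h1
  | m + 1, f, g, h => by
    -- Either the last functional is redundant and gets coefficient 0, or some x₀ violates only it.
    by_cases hm : ∀ x, (∀ i : Fin m, 0 ≤ f i.castSucc x) → 0 ≤ g x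
    · obtain ⟨y, hy, rfl⟩ := exists_nonneg_sum_of_forall_nonneg m _ g hm
      refine ⟨Fin.snoc y 0, fun i => ?_, by simp [Fin.sum_univ_castSucc]⟩
      induction i using Fin.lastCases <;> simp [hy]
    · push Not at hm
      obtain ⟨x₀, hx₀, hg⟩ := hm
      have hl : f (Fin.last m) x₀ < 0 := by
        by_contra! hl
        refine hg.not_ge (h x₀ fun i => ?_)
        induction i using Fin.lastCases <;> simp [hl, hx₀]
      set a := f (Fin.last m)
      -- Project onto ker a along x₀: there the last constraint holds trivially, so the induction
      -- hypothesis applies to the projected functionals.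
      have key : ∀ (φ : E →ₗ[ℝ] ℝ) x,
          (φ - (φ x₀ / a x₀) • a) x = φ (x - (a x / a x₀) • x₀) := fun φ x => by
        simp; ring
      obtain ⟨y, hy, hgy⟩ := exists_nonneg_sum_of_forall_nonneg m
        (fun i => f i.castSucc - (f i.castSucc x₀ / a x₀) • a) (g - (g x₀ / a x₀) • a) (by
          intro x hx
          simp only [key] at hx ⊢
          refine h _ fun i => ?_
          induction i using Fin.lastCases with
          | last =>
            have : a (x - (a x / a x₀) • x₀) = 0 := by simp [hl.ne]
            exact this.ge
          | cast i => exact hx i)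
      refine ⟨Fin.snoc y ((g x₀ - ∑ i, y i * f i.castSucc x₀) / a x₀), fun i => ?_, ?_⟩
      · induction i using Fin.lastCases with
        | last =>
          have := Finset.sum_nonneg fun i (_ : i ∈ Finset.univ) => mul_nonneg (hy i) (hx₀ i)
          simpa using div_nonneg_of_nonpos (by linarith) hl.le
        | cast i => simp [hy]
      · rw [sub_eq_iff_eq_add] at hgy
        rw [Fin.sum_univ_castSucc]
        simp only [Fin.snoc_castSucc, Fin.snoc_last]
        refine hgy.trans (LinearMap.ext fun x => ?_)
        simp [sub_div, Finset.sum_div, mul_sub, sub_mul, Finset.sum_mul]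
        simp only [mul_div_assoc, mul_assoc]
        ring

theorem exists_nonneg_sum_of_forall_nonneg_fintype {E ι : Type*} [AddCommGroup E] [Module ℝ E]
    [Fintype ι] (f : ι → E →ₗ[ℝ] ℝ) (g : E →ₗ[ℝ] ℝ)
    (h : ∀ x, (∀ i, 0 ≤ f i x) → 0 ≤ g x) :
    ∃ y : ι → ℝ, (∀ i, 0 ≤ y i) ∧ g = ∑ i, y i • f i := by
  let e := Fintype.equivFin ι
  obtain ⟨y, hy, hg⟩ := exists_nonneg_sum_of_forall_nonneg _ (fun i => f (e.symm i)) g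
    fun x hx => h x fun i => by simpa using hx (e i)
  refine ⟨y ∘ e, fun i => hy _, hg.trans ?_⟩
  exact (Fintype.sum_equiv e _ _ fun i => by simp).symm

/-- An affine function that is nonnegative on a nonempty polyhedron `{x | A x ≤ b}` is a
nonnegative combination of `1` and the slacks `b i - (A x) i`. -/
theorem AffineMap.exists_nonneg_of_nonneg_on_polyhedron {ι κ : Type*} [Fintype ι] [Fintype κ]
    {A : Matrix ι κ ℝ} {b : ι → ℝ} (hP : (polyhedron A b).Nonempty) (α : (κ → ℝ) →ᵃ[ℝ] ℝ)
    (hα : ∀ x ∈ polyhedron A b, 0 ≤ α x) :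
    ∃ (y₀ : ℝ) (y : ι → ℝ), 0 ≤ y₀ ∧ (∀ i, 0 ≤ y i) ∧
      ∀ x, α x = y₀ + ∑ i, y i * (b i - (A *ᵥ x) i) := by
  obtain ⟨p, hp⟩ := hP
  have hlin : ∀ x, α x = α.linear x + α 0 := fun x => congrFun α.decomp x
  -- Homogenize by a variable t: `none` stands for t ≥ 0, whose multiplier becomes the constant y₀.
  let f : Option ι → ((κ → ℝ) × ℝ) →ₗ[ℝ] ℝ := fun o => o.elim (LinearMap.snd ℝ _ _)
    fun i => b i • LinearMap.snd ℝ _ _ - LinearMap.proj i ∘ₗ A.mulVecLin ∘ₗ LinearMap.fst ℝ _ _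
  obtain ⟨y, hy, h⟩ := exists_nonneg_sum_of_forall_nonneg_fintype f
    (α.linear ∘ₗ LinearMap.fst ℝ _ _ + α 0 • LinearMap.snd ℝ _ _) (by
      rintro ⟨x, t⟩ hx
      have ht : 0 ≤ t := hx none
      have hx' : ∀ i, (A *ᵥ x) i ≤ b i * t := fun i => by simpa [f] using hx (some i)
      change 0 ≤ α.linear x + α 0 * t
      rcases ht.eq_or_lt with rfl | ht
      -- For t = 0, x is a recession direction, and moving from p along x would bring α down to -1
      -- inside the polyhedron.
      · by_contra! hneg
        simp only [mul_zero, add_zero] at hneg hx'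
        have hs : ∀ s : ℝ, 0 ≤ s → 0 ≤ α p + s * α.linear x := fun s hs => by
          have := hα (p + s • x) (by
            change A *ᵥ (p + s • x) ≤ b
            intro i
            rw [mulVec_add, mulVec_smul]
            have h1 : (A *ᵥ p) i ≤ b i := hp i
            have h2 := mul_nonpos_of_nonneg_of_nonpos hs (hx' i)
            simp only [Pi.add_apply, Pi.smul_apply, smul_eq_mul]; linarith)
          rw [hlin, map_add, map_smul, smul_eq_mul] at this
          rw [hlin p]; linarith
        have h0 := hα p hp
        have := hs ((α p + 1) / -α.linear x) (by
          have : 0 < -α.linear x := by linarith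
          positivity)
        have h1 : (α p + 1) / -α.linear x * α.linear x = -(α p + 1) := by
          rw [div_neg, neg_mul, div_mul_cancel₀ _ hneg.ne]
        linarith
      · have := hα (t⁻¹ • x) (by
          change A *ᵥ (t⁻¹ • x) ≤ b
          intro i
          rw [mulVec_smul, Pi.smul_apply, smul_eq_mul, inv_mul_le_iff₀ ht, mul_comm]
          exact hx' i)
        rw [hlin, map_smul, smul_eq_mul] at this
        have h2 := mul_nonneg ht.le this
        rw [mul_add, mul_inv_cancel_left₀ ht.ne'] at h2
        linarith)
  refine ⟨y none, fun i => y (some i), hy _, fun i => hy _, fun x => ?_⟩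
  have := LinearMap.congr_fun h (x, 1)
  simp [f, Fintype.sum_option] at this
  rw [hlin, this]

end Farkas

/-! ### The semidefinite form of the bound and its conic dual -/

section Bound

variable {ι κ : Type*} [Fintype κ]

/-- The entrywise linearization of `(t b - A x) (t b - A x)ᵀ`, with `X` in place of `x xᵀ`. -/
def slackMatrix (A : Matrix ι κ ℝ) (b : ι → ℝ) (X : Matrix κ κ ℝ) (x : κ → ℝ) (t : ℝ) :
    Matrix ι ι ℝ :=
  A * X * Aᵀ - vecMulVec b (A *ᵥ x) - vecMulVec (A *ᵥ x) b + t • vecMulVec b b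

theorem slackMatrix_isSymm (A : Matrix ι κ ℝ) (b : ι → ℝ) {X : Matrix κ κ ℝ} (hX : X.IsSymm)
    (x : κ → ℝ) (t : ℝ) : (slackMatrix A b X x t).IsSymm := by
  simp only [slackMatrix, IsSymm, transpose_add, transpose_sub, transpose_mul, transpose_transpose,
    transpose_vecMulVec, transpose_smul, hX.eq, Matrix.mul_assoc]
  abel

theorem slackMatrix_vecMulVec (A : Matrix ι κ ℝ) (b : ι → ℝ) (x : κ → ℝ) :
    slackMatrix A b (vecMulVec x x) x 1 = vecMulVec (b - A *ᵥ x) (b - A *ᵥ x) := by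
  rw [slackMatrix, mul_vecMulVec, vecMulVec_mul, vecMul_transpose]
  ext i j
  simp [vecMulVec_apply]
  ring

theorem relaxFeasible_iff (A : Matrix ι κ ℝ) (b : ι → ℝ) (x : κ → ℝ) (X : Matrix κ κ ℝ) :
    RelaxFeasible A b x X ↔
      (∀ i j, 0 ≤ slackMatrix A b X x 1 i j) ∧ A *ᵥ x ≤ b ∧ (X - vecMulVec x x).PosSemidef := by
  refine and_congr (forall₂_congr fun i j => ?_) Iff.rfl
  rw [← sub_nonneg, slackMatrix, one_smul, Matrix.add_apply, Matrix.neg_apply, sub_neg_eq_add]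

theorem relaxFeasible_vecMulVec {A : Matrix ι κ ℝ} {b : ι → ℝ} {x : κ → ℝ}
    (hx : x ∈ polyhedron A b) : RelaxFeasible A b x (vecMulVec x x) := by
  rw [relaxFeasible_iff, slackMatrix_vecMulVec, sub_self]
  have hx' : ∀ i, (A *ᵥ x) i ≤ b i := hx
  exact ⟨fun i j => mul_nonneg (sub_nonneg.2 (hx' i)) (sub_nonneg.2 (hx' j)), hx, PosSemidef.zero⟩

theorem relaxObj_vecMulVec (Q : Matrix κ κ ℝ) (c x : κ → ℝ) :
    relaxObj Q c x (vecMulVec x x) = quadFun Q c x := by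
  rw [relaxObj, trace_mul_transpose_vecMulVec, quadFun]

variable [Fintype ι]

/-- The adjoint of `boundMap`: each of Y, y, ℓ is paired with the dual constraint that it enforces.
-/
theorem symPairing_boundMap (A : Matrix ι κ ℝ) (b : ι → ℝ) (v : symMatrix ι × (ι → ℝ) × ℝ)
    {Z : symMatrix (κ ⊕ Unit)} {X : Matrix κ κ ℝ} {x : κ → ℝ} {t : ℝ}
    (hZ : (Z : Matrix (κ ⊕ Unit) (κ ⊕ Unit) ℝ) = bordered X x t) :
    symPairing (κ ⊕ Unit) (boundMap A b v) Z =
      -trace ((v.1 : Matrix ι ι ℝ) * (slackMatrix A b X x t)ᵀ) - v.2.1 ⬝ᵥ (t • b - A *ᵥ x) -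
        v.2.2 * t := by
  obtain ⟨⟨Y, hY⟩, y, ℓ⟩ := v
  have hY' : Yᵀ = Y := hY
  change trace (bordered _ _ _ * (Z : Matrix (κ ⊕ Unit) (κ ⊕ Unit) ℝ)ᵀ) = _
  rw [hZ, trace_bordered_mul_transpose]
  have h1 : trace (Y * (A * X * Aᵀ)ᵀ) = trace (Aᵀ * Y * A * Xᵀ) := by
    rw [transpose_mul, transpose_mul, transpose_transpose, ← Matrix.mul_assoc, ← Matrix.mul_assoc,
      trace_mul_comm, ← Matrix.mul_assoc, ← Matrix.mul_assoc]
  have h2 : trace (Y * (vecMulVec b (A *ᵥ x))ᵀ) = (Y *ᵥ b) ⬝ᵥ A *ᵥ x := by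
    rw [transpose_vecMulVec, mul_vecMulVec, trace_vecMulVec, dotProduct_comm, dotProduct_mulVec,
      ← mulVec_transpose, hY']
  have h3 : trace (Y * (vecMulVec (A *ᵥ x) b)ᵀ) = (Y *ᵥ b) ⬝ᵥ A *ᵥ x := by
    rw [transpose_vecMulVec, mul_vecMulVec, trace_vecMulVec]
  have h4 : (Aᵀ *ᵥ (Y *ᵥ b + (1 / 2 : ℝ) • y)) ⬝ᵥ x =
      (Y *ᵥ b) ⬝ᵥ A *ᵥ x + 1 / 2 * (y ⬝ᵥ A *ᵥ x) := by
    rw [mulVec_transpose, ← dotProduct_mulVec, add_dotProduct, smul_dotProduct, smul_eq_mul]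
  simp only [slackMatrix, transpose_add, transpose_sub, Matrix.mul_add, Matrix.mul_sub, trace_add,
    trace_sub, h1, h2, h3, h4, transpose_smul, Matrix.mul_smul, trace_smul,
    trace_mul_transpose_vecMulVec, dotProduct_sub, dotProduct_smul, smul_eq_mul, Matrix.neg_mul,
    trace_neg]
  ring

theorem symPairing_off (A : Matrix ι κ ℝ) (b : ι → ℝ) {Q : Matrix κ κ ℝ} (hQ : Q.IsSymm)
    (c : κ → ℝ) {Z : symMatrix (κ ⊕ Unit)} {X : Matrix κ κ ℝ} {x : κ → ℝ} {t : ℝ}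
    (hZ : (Z : Matrix (κ ⊕ Unit) (κ ⊕ Unit) ℝ) = bordered X x t) :
    symPairing (κ ⊕ Unit) (boundSDP A b Q hQ c).off Z = relaxObj Q c x X := by
  change trace (bordered _ _ _ * (Z : Matrix (κ ⊕ Unit) (κ ⊕ Unit) ℝ)ᵀ) = _
  rw [hZ, trace_bordered_mul_transpose, relaxObj, zero_mul, add_zero]

/-- Pairing the constraint matrix with [xxᵀ, x; xᵀ, 1] evaluates its quadratic polynomial at x, so
the adjoint formula computes that polynomial. -/
theorem boundSDP_feasible_iff (A : Matrix ι κ ℝ) (b : ι → ℝ) {Q : Matrix κ κ ℝ} (hQ : Q.IsSymm)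
    (c : κ → ℝ) (Y : symMatrix ι) (y : ι → ℝ) (ℓ : ℝ) :
    (boundSDP A b Q hQ c).Feasible (Y, y, ℓ) ↔
      ((∀ i j, 0 ≤ (Y : Matrix ι ι ℝ) i j) ∧ ∀ i, 0 ≤ y i) ∧
      ∀ x, 0 ≤ quadFun Q c x - ℓ - (b - A *ᵥ x) ⬝ᵥ (Y : Matrix ι ι ℝ) *ᵥ (b - A *ᵥ x) -
        y ⬝ᵥ (b - A *ᵥ x) := by
  refine and_congr Iff.rfl ?_
  obtain ⟨M, m, t, hM, hZ⟩ := exists_eq_bordered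
    ((boundSDP A b Q hQ c).off + (boundSDP A b Q hQ c).map (Y, y, ℓ)).2
  change Matrix.PosSemidef (Subtype.val _) ↔ _
  rw [hZ, posSemidef_bordered_iff_forall hM]
  refine forall_congr' fun x => ?_
  let Z : symMatrix (κ ⊕ Unit) := ⟨bordered (vecMulVec x x) x 1,
    bordered_isSymm (transpose_vecMulVec x x) x 1⟩
  have h : symPairing (κ ⊕ Unit)
      ((boundSDP A b Q hQ c).off + (boundSDP A b Q hQ c).map (Y, y, ℓ)) Z =
      x ⬝ᵥ M *ᵥ x + 2 * (m ⬝ᵥ x) + t := by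
    change trace (Subtype.val _ * _) = _
    rw [hZ, trace_bordered_mul_transpose, trace_mul_transpose_vecMulVec, mul_one]
  rw [← h, map_add, LinearMap.add_apply, symPairing_off A b hQ c (Z := Z) rfl, relaxObj_vecMulVec]
  change 0 ≤ _ + symPairing (κ ⊕ Unit) (boundMap A b (Y, y, ℓ)) Z ↔ _
  rw [symPairing_boundMap A b _ (Z := Z) rfl, slackMatrix_vecMulVec, trace_mul_transpose_vecMulVec]
  simp only [one_smul, mul_one]
  refine Iff.of_eq (congrArg _ ?_)
  ring

theorem dotProduct_mulVec_half_add_transpose (Y : Matrix ι ι ℝ) (r : ι → ℝ) :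
    r ⬝ᵥ ((1 / 2 : ℝ) • (Y + Yᵀ)) *ᵥ r = r ⬝ᵥ Y *ᵥ r := by
  rw [smul_mulVec, add_mulVec, dotProduct_smul, dotProduct_add, mulVec_transpose,
    dotProduct_comm r (r ᵥ* Y), ← dotProduct_mulVec, smul_eq_mul]
  ring

theorem sum_affine_mul_slack (A : Matrix ι κ ℝ) (b : ι → ℝ) (Y : Matrix ι ι ℝ) (y : ι → ℝ)
    (x : κ → ℝ) :
    ∑ i, (y i + ∑ j, Y i j * (b j - (A *ᵥ x) j)) * ((A *ᵥ x) i - b i) =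
      -((b - A *ᵥ x) ⬝ᵥ Y *ᵥ (b - A *ᵥ x)) - y ⬝ᵥ (b - A *ᵥ x) := by
  simp only [dotProduct, mulVec, Pi.sub_apply]
  rw [← Finset.sum_neg_distrib, ← Finset.sum_sub_distrib]
  exact Finset.sum_congr rfl fun i _ => by ring

/-- The bound with affine multipliers is a semidefinite program. -/
theorem exists_boundFeasible_iff {A : Matrix ι κ ℝ} {b : ι → ℝ} (hP : (polyhedron A b).Nonempty)
    {Q : Matrix κ κ ℝ} (hQ : Q.IsSymm) (c : κ → ℝ) (ℓ : ℝ) :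
    (∃ α, BoundFeasible A b Q c ℓ α) ↔ ∃ Y y, (boundSDP A b Q hQ c).Feasible (Y, y, ℓ) := by
  simp only [boundSDP_feasible_iff]
  constructor
  · rintro ⟨α, h, hα⟩
    choose y Y hy hY hαY using fun i =>
      AffineMap.exists_nonneg_of_nonneg_on_polyhedron hP (α i) (hα i)
    -- The Farkas multipliers need not form a symmetric matrix; symmetrizing preserves signs and the
    -- quadratic form.
    refine ⟨⟨(1 / 2 : ℝ) • (of Y + (of Y)ᵀ), ?_⟩, y, ⟨fun i j => ?_, hy⟩, fun x => ?_⟩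
    · change _ = _
      rw [transpose_smul, transpose_add, transpose_transpose, add_comm]
    · have := add_nonneg (hY i j) (hY j i)
      simpa using this
    · have := h x
      simp only [hαY] at this
      have e := sum_affine_mul_slack A b (of Y) y x
      simp only [of_apply] at e
      rw [e] at this
      rw [dotProduct_mulVec_half_add_transpose]
      linarith
  · rintro ⟨Y, y, ⟨hY, hy⟩, h⟩
    let α : ι → (κ → ℝ) →ᵃ[ℝ] ℝ := fun i =>
      AffineMap.const ℝ _ (y i + ((Y : Matrix ι ι ℝ) *ᵥ b) i) -
        (LinearMap.proj i ∘ₗ ((Y : Matrix ι ι ℝ) * A).mulVecLin).toAffineMap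
    have hα : ∀ i x, α i x = y i + ∑ j, (Y : Matrix ι ι ℝ) i j * (b j - (A *ᵥ x) j) := by
      intro i x
      change y i + ((Y : Matrix ι ι ℝ) *ᵥ b) i - (((Y : Matrix ι ι ℝ) * A) *ᵥ x) i = _
      rw [← mulVec_mulVec]
      simp only [mulVec, dotProduct, mul_sub, Finset.sum_sub_distrib]
      ring
    refine ⟨α, fun x => ?_, fun i x hx => ?_⟩
    · simp only [hα]
      rw [sum_affine_mul_slack]
      linarith [h x]
    · rw [hα]
      have hx' : ∀ i, (A *ᵥ x) i ≤ b i := hx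
      exact add_nonneg (hy i) (Finset.sum_nonneg fun j _ =>
        mul_nonneg (hY i j) (sub_nonneg.2 (hx' j)))

theorem trace_mul_transpose_eq_sum (Y W : Matrix ι ι ℝ) :
    trace (Y * Wᵀ) = ∑ i, ∑ j, Y i j * W i j := by
  simp [trace, Matrix.mul_apply]

/-- The dual of the cone of pairs of a symmetric nonnegative matrix and a nonnegative vector. -/
theorem forall_trace_add_dotProduct_nonneg_iff {W : Matrix ι ι ℝ} (hW : W.IsSymm) (w : ι → ℝ) :
    (∀ v ∈ boundCone ι, 0 ≤ trace ((v.1 : Matrix ι ι ℝ) * Wᵀ) + v.2.1 ⬝ᵥ w) ↔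
      (∀ i j, 0 ≤ W i j) ∧ ∀ i, 0 ≤ w i := by
  classical
  constructor
  · refine fun h => ⟨fun i j => ?_, fun i => ?_⟩
    · have := h (⟨single i j 1 + single j i 1, by
        change _ = _
        rw [transpose_add, transpose_single, transpose_single, add_comm]⟩, 0, 0)
        ⟨fun k l => ?_, fun k => le_rfl⟩
      · have hs : ∀ i j, trace (single i j 1 * W) = W j i := fun i j => by
          simp [trace_single_mul]
        rw [hW.eq] at this
        simp only [Matrix.add_mul, trace_add, hs, zero_dotProduct, add_zero] at this
        have := hW.apply i j
        linarith
      · simp only [Matrix.add_apply, single_apply]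
        positivity
    · have := h (0, Pi.single i 1, 0) ⟨fun k l => le_rfl, fun k => ?_⟩
      · simpa using this
      · simp only [Pi.single_apply]; positivity
  · rintro ⟨hW, hw⟩ v ⟨hY, hy⟩
    rw [trace_mul_transpose_eq_sum]
    exact add_nonneg (Finset.sum_nonneg fun i _ => Finset.sum_nonneg fun j _ =>
      mul_nonneg (hY i j) (hW i j)) (Finset.sum_nonneg fun i _ => mul_nonneg (hy i) (hw i))

/-- The conic dual of the semidefinite program is the semidefinite relaxation. -/
theorem boundSDP_dualFeasible_iff (A : Matrix ι κ ℝ) (b : ι → ℝ) {Q : Matrix κ κ ℝ}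
    (hQ : Q.IsSymm) (c : κ → ℝ) (Z : symMatrix (κ ⊕ Unit)) :
    (boundSDP A b Q hQ c).DualFeasible (symPairing (κ ⊕ Unit)) Z ↔
      ∃ x X, RelaxFeasible A b x X ∧
        (Z : Matrix (κ ⊕ Unit) (κ ⊕ Unit) ℝ) = bordered X x 1 := by
  have hd : (boundSDP A b Q hQ c).DualFeasible (symPairing (κ ⊕ Unit)) Z ↔
      (Z : Matrix (κ ⊕ Unit) (κ ⊕ Unit) ℝ).PosSemidef ∧
      ∀ v ∈ boundCone ι, 0 ≤ -(v.2.2 + symPairing (κ ⊕ Unit) (boundMap A b v) Z) :=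
    and_congr (mem_dual_psdCone Z) Iff.rfl
  rw [hd]
  constructor
  · rintro ⟨hpsd, h⟩
    obtain ⟨X, x, t, hX, hZ⟩ := exists_eq_bordered Z.2
    simp only [symPairing_boundMap A b _ hZ] at h
    have ht : t = 1 := by
      -- ℓ is free, so both of its directions are tested.
      have h1 := h (0, 0, 1) ⟨fun _ _ => le_rfl, fun _ => le_rfl⟩
      have h2 := h (0, 0, -1) ⟨fun _ _ => le_rfl, fun _ => le_rfl⟩
      simp at h1 h2
      linarith
    subst ht
    refine ⟨x, X, ?_, hZ⟩
    have := (forall_trace_add_dotProduct_nonneg_iff (slackMatrix_isSymm A b hX x 1)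
      ((1 : ℝ) • b - A *ᵥ x)).1 fun v hv => by linarith [h v hv]
    rw [relaxFeasible_iff]
    refine ⟨this.1, fun i => ?_, (posSemidef_bordered_one_iff x).1 (hZ ▸ hpsd)⟩
    simpa using this.2 i
  · rintro ⟨x, X, h, hZ⟩
    rw [relaxFeasible_iff] at h
    refine ⟨hZ ▸ (posSemidef_bordered_one_iff x).2 h.2.2, fun v hv => ?_⟩
    rw [symPairing_boundMap A b _ hZ]
    have hX : X.IsSymm := isSymm_of_bordered (hZ ▸ Z.2)
    have := (forall_trace_add_dotProduct_nonneg_iff (slackMatrix_isSymm A b hX x 1)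
      ((1 : ℝ) • b - A *ᵥ x)).2 ⟨h.1, fun i => by simpa using h.2.1 i⟩ v hv
    linarith

end Bound

/-! ### Separation from a sum of cones -/

section Separation

/-- The identity matrix as an element of the space of symmetric matrices. -/
def symOne (n : Type*) [DecidableEq n] : symMatrix n := ⟨1, isSymm_one⟩

theorem symOne_mem_psdCone {n : Type*} [DecidableEq n] : symOne n ∈ psdCone n := PosSemidef.one

/-- The term ε • I replaces the semidefinite cone by its interior: the set is then open, and
Hahn–Banach applies even when the sum of the two cones is not closed. -/
theorem convex_setOf_exists_sub_smul_symOne_mem {n : Type*} [DecidableEq n]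
    (G : PointedCone ℝ (symMatrix n)) :
    Convex ℝ {M : symMatrix n | ∃ ε : ℝ, 0 < ε ∧ ∃ g ∈ G, M - g - ε • symOne n ∈ psdCone n} := by
  refine convex_iff_forall_pos.2 ?_
  rintro M ⟨ε, hε, g, hg, h⟩ M' ⟨ε', hε', g', hg', h'⟩ a a' ha ha' -
  refine ⟨a * ε + a' * ε', by positivity, a • g + a' • g', G.add_mem
    (G.smul_mem ha.le hg)
    (G.smul_mem ha'.le hg'), ?_⟩
  have h3 : a • M + a' • M' - (a • g + a' • g') - (a * ε + a' * ε') • symOne n =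
      a • (M - g - ε • symOne n) + a' • (M' - g' - ε' • symOne n) := by
    module
  rw [h3]
  exact (psdCone n).add_mem ((psdCone n).smul_mem ha.le h)
    ((psdCone n).smul_mem ha'.le h')

variable {n : Type*} [Fintype n]

/-- Every linear functional on symmetric matrices is an inner product with such a matrix. -/
theorem exists_symPairing_eq (f : symMatrix n →ₗ[ℝ] ℝ) :
    ∃ Z : symMatrix n, ∀ M, f M = symPairing n M Z := by
  classical
  have hnd : Function.Injective (symPairing n).flip := by
    rw [injective_iff_map_eq_zero]
    intro Z hZ
    have : trace ((Z : Matrix n n ℝ) * (Z : Matrix n n ℝ)ᵀ) = 0 := LinearMap.congr_fun hZ Z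
    rw [← conjTranspose_eq_transpose_of_trivial, trace_mul_conjTranspose_self_eq_zero_iff] at this
    exact Subtype.ext this
  have hs := (LinearMap.injective_iff_surjective_of_finrank_eq_finrank
    (Subspace.dual_finrank_eq (K := ℝ) (V := symMatrix n)).symm).1 hnd
  obtain ⟨Z, hZ⟩ := hs f
  exact ⟨Z, fun M => (LinearMap.congr_fun hZ M).symm⟩

theorem abs_dotProduct_mulVec_le {M : Matrix n n ℝ} {δ : ℝ} (hM : ∀ i j, |M i j| ≤ δ)
    (x : n → ℝ) : |x ⬝ᵥ M *ᵥ x| ≤ δ * Fintype.card n * (x ⬝ᵥ x) := by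
  have h1 : |x ⬝ᵥ M *ᵥ x| ≤ ∑ i, ∑ j, δ * ((x i ^ 2 + x j ^ 2) / 2) := by
    simp only [dotProduct, mulVec, Finset.mul_sum]
    refine (Finset.abs_sum_le_sum_abs _ _).trans (Finset.sum_le_sum fun i _ =>
      (Finset.abs_sum_le_sum_abs _ _).trans (Finset.sum_le_sum fun j _ => ?_))
    have h2 : |x i * (M i j * x j)| = |M i j| * (|x i| * |x j|) := by
      rw [abs_mul, abs_mul]; ring
    rw [h2]
    refine mul_le_mul (hM i j) ?_ (by positivity) ((abs_nonneg _).trans (hM i j))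
    rw [← sq_abs (x i), ← sq_abs (x j)]
    linarith [two_mul_le_add_sq |x i| |x j|]
  refine h1.trans_eq ?_
  simp only [← Finset.mul_sum, ← Finset.sum_div, Finset.sum_add_distrib, Finset.sum_const,
    Finset.card_univ, nsmul_eq_mul, dotProduct, ← pow_two]
  ring

variable [DecidableEq n]

/-- The identity matrix is an interior point of the cone of positive semidefinite matrices. -/
theorem posSemidef_add_smul_one {M : Matrix n n ℝ} (hM : M.IsSymm) {δ ε : ℝ}
    (hδ : ∀ i j, |M i j| ≤ δ) (hε : δ * Fintype.card n ≤ ε) : (M + ε • 1).PosSemidef := by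
  refine posSemidef_iff_isSymm_and_nonneg.2 ⟨hM.add (isSymm_one.smul ε), fun x => ?_⟩
  have h := abs_le.1 (abs_dotProduct_mulVec_le hδ x)
  have h0 : 0 ≤ x ⬝ᵥ x := by simpa using dotProduct_star_self_nonneg x
  rw [add_mulVec, smul_mulVec, one_mulVec, dotProduct_add, dotProduct_smul, smul_eq_mul]
  have := mul_le_mul_of_nonneg_right hε h0
  linarith [h.1]

attribute [local instance] Matrix.normedAddCommGroup Matrix.normedSpace

theorem isOpen_setOf_exists_sub_smul_symOne_mem (G : PointedCone ℝ (symMatrix n)) :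
    IsOpen {M : symMatrix n | ∃ ε : ℝ, 0 < ε ∧ ∃ g ∈ G, M - g - ε • symOne n ∈ psdCone n} := by
  refine Metric.isOpen_iff.2 ?_
  rintro M ⟨ε, hε, g, hg, h⟩
  -- Half of ε • I absorbs a perturbation whose entries are below this radius; the `+ 1` covers an
  -- empty index type.
  refine ⟨ε / 2 / (Fintype.card n + 1), by positivity, fun M' hM' =>
    ⟨ε / 2, by positivity, g, hg, ?_⟩⟩
  rw [mem_ball_iff_norm] at hM'
  have h1 : M' - M + (ε / 2) • symOne n ∈ psdCone n := by
    refine posSemidef_add_smul_one (M' - M).2 (δ := ‖M' - M‖)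
      (fun i j => Matrix.norm_entry_le_entrywise_sup_norm (M' - M : symMatrix n).1) ?_
    rw [lt_div_iff₀ (by positivity)] at hM'
    nlinarith [norm_nonneg (M' - M)]
  have h2 := (psdCone n).add_mem h h1
  have h3 : M' - g - (ε / 2) • symOne n =
      M - g - ε • symOne n + (M' - M + (ε / 2) • symOne n) := by
    module
  rwa [h3]

/-- A symmetric matrix outside of the sum of the cone of positive semidefinite matrices and a
convex cone `G` is weakly separated from this sum by a nonzero positive semidefinite matrix. -/
theorem exists_posSemidef_separating (G : PointedCone ℝ (symMatrix n)) (H : symMatrix n)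
    (h : ∀ g ∈ G, H - g ∉ psdCone n) :
    ∃ Z : symMatrix n, Z ≠ 0 ∧ (Z : Matrix n n ℝ).PosSemidef ∧
      (∀ g ∈ G, 0 ≤ symPairing n g Z) ∧ symPairing n H Z ≤ 0 := by
  obtain ⟨f, hf⟩ := geometric_hahn_banach_point_open (x := H)
    (convex_setOf_exists_sub_smul_symOne_mem G) (isOpen_setOf_exists_sub_smul_symOne_mem G) (by
      rintro ⟨ε, hε, g, hg, hH⟩
      refine h g hg ?_
      have := (psdCone n).add_mem hH
        ((psdCone n).smul_mem hε.le symOne_mem_psdCone)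
      have e : H - g - ε • symOne n + ε • symOne n = H - g :=
        sub_add_cancel _ _
      rwa [e] at this)
  have key : ∀ M ∈ psdCone n, ∀ g ∈ G, ∀ ε : ℝ, 0 < ε → f H < f M + f g + ε * f (symOne n) := by
    intro M hM g hg ε hε
    have := hf (M + g + ε • symOne n) ⟨ε, hε, g, hg, by
      rwa [add_sub_right_comm, add_sub_cancel_right, add_sub_cancel_right]⟩
    simpa using this
  have hlim : ∀ M ∈ psdCone n, ∀ g ∈ G, f H ≤ f M + f g := by
    intro M hM g hg
    refine ge_of_tendsto (x := nhdsWithin 0 (Set.Ioi (0 : ℝ)))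
      (f := fun ε : ℝ => f M + f g + ε * f (symOne n)) ?_
      (Filter.eventually_of_mem self_mem_nhdsWithin fun ε hε => (key M hM g hg ε hε).le)
    have : Filter.Tendsto (fun ε : ℝ => f M + f g + ε * f (symOne n)) (nhds 0)
        (nhds (f M + f g + 0 * f (symOne n))) := Continuous.tendsto (by fun_prop) 0
    rw [zero_mul, add_zero] at this
    exact this.mono_left nhdsWithin_le_nhds
  -- A linear functional bounded below on a cone is nonnegative there, by scaling.
  have hcone : ∀ C : PointedCone ℝ (symMatrix n), (∀ M ∈ C, f H ≤ f M) → ∀ M ∈ C, 0 ≤ f M := by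
    intro C hC M hM
    by_contra! hneg
    have h1 := hC _ (C.smul_mem (r := (|f H| + 1) / -f M) (div_nonneg (by positivity)
      (by linarith)) hM)
    change f H ≤ f (((|f H| + 1) / -f M) • M) at h1
    rw [map_smul, smul_eq_mul, div_neg, neg_mul, div_mul_cancel₀ _ hneg.ne] at h1
    linarith [neg_abs_le (f H)]
  obtain ⟨Z, hZ⟩ := exists_symPairing_eq f.toLinearMap
  have hZ' : ∀ M, f M = symPairing n M Z := hZ
  refine ⟨Z, ?_, ?_, ?_, ?_⟩
  · rintro rfl
    have := key 0 (psdCone n).zero_mem 0 G.zero_mem 1 one_pos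
    simp [hZ'] at this
  · rw [← mem_dual_psdCone]
    intro M hM
    rw [← hZ']
    exact hcone _ (fun M hM => by simpa using hlim M hM 0 G.zero_mem) M hM
  · intro g hg
    rw [← hZ']
    exact hcone G (fun g hg => by simpa using hlim 0 (psdCone n).zero_mem g hg) g hg
  · rw [← hZ']
    simpa using hlim 0 (psdCone n).zero_mem 0 G.zero_mem

end Separation

/-! ### Strong duality from boundedness -/

section StrongDuality

theorem eq_zero_of_mulVec_nonpos {ι κ : Type*} [Fintype κ] {A : Matrix ι κ ℝ} {b : ι → ℝ}
    (hP : (polyhedron A b).Nonempty) (hB : Bornology.IsBounded (polyhedron A b)) {w : κ → ℝ}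
    (hw : A *ᵥ w ≤ 0) : w = 0 := by
  obtain ⟨p, hp⟩ := hP
  obtain ⟨R, hR⟩ := hB.exists_norm_le
  by_contra hne
  have hn : 0 < ‖w‖ := norm_pos_iff.2 hne
  -- A step of length 2R + 1 along w stays in the polyhedron, yet two of its points are at most 2R
  -- apart.
  have hs : 0 ≤ (2 * R + 1) / ‖w‖ := by
    have := (norm_nonneg p).trans (hR p hp)
    positivity
  have hmem : p + ((2 * R + 1) / ‖w‖) • w ∈ polyhedron A b := by
    change A *ᵥ _ ≤ b
    rw [mulVec_add, mulVec_smul]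
    exact (add_le_add hp (smul_nonpos_of_nonneg_of_nonpos hs hw)).trans_eq (add_zero b)
  have h1 := hR _ hmem
  have h2 := norm_sub_le (p + ((2 * R + 1) / ‖w‖) • w) p
  rw [add_sub_cancel_left, norm_smul, Real.norm_of_nonneg hs, div_mul_cancel₀ _ hn.ne'] at h2
  linarith [hR p hp]

variable {ι κ : Type*} [Fintype ι] [Fintype κ]

/-- The recession cone of the semidefinite relaxation over a polytope is trivial. -/
theorem corner_pos_of_bounded {A : Matrix ι κ ℝ} {b : ι → ℝ}
    (hP : (polyhedron A b).Nonempty) (hB : Bornology.IsBounded (polyhedron A b))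
    {Z : symMatrix (κ ⊕ Unit)} (hne : Z ≠ 0)
    (hpsd : (Z : Matrix (κ ⊕ Unit) (κ ⊕ Unit) ℝ).PosSemidef)
    (h : ∀ v ∈ boundCone ι, v.2.2 = 0 → symPairing (κ ⊕ Unit) (boundMap A b v) Z ≤ 0)
    {X : Matrix κ κ ℝ} {x : κ → ℝ} {t : ℝ}
    (hZ : (Z : Matrix (κ ⊕ Unit) (κ ⊕ Unit) ℝ) = bordered X x t) : 0 < t := by
  have hX : X.IsSymm := isSymm_of_bordered (hZ ▸ Z.2)
  have ht : 0 ≤ t := by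
    have := hpsd.diag_nonneg (i := .inr ())
    rwa [hZ] at this
  refine ht.lt_of_ne fun h0 => hne ?_
  subst h0
  obtain rfl := eq_zero_of_posSemidef_bordered_zero (hZ ▸ hpsd)
  have hW := ((forall_trace_add_dotProduct_nonneg_iff (slackMatrix_isSymm A b hX 0 0)
    ((0 : ℝ) • b - A *ᵥ 0)).1 fun v hv => by
      have := h (v.1, v.2.1, 0) hv rfl
      rw [symPairing_boundMap A b _ hZ] at this
      simp only at this
      linarith).1
  -- With x = 0 and t = 0 only AXAᵀ ≥ 0 remains, so each -XA_i is a recession direction of P. By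
  -- symmetry A then kills every column of X.
  have hXA : ∀ i, X *ᵥ A i = 0 := by
    intro i
    rw [← neg_eq_zero]
    refine eq_zero_of_mulVec_nonpos hP hB fun j => ?_
    have h1 : (A * X * Aᵀ) j i = (A *ᵥ X *ᵥ A i) j := by
      rw [Matrix.mul_assoc]; rfl
    have := hW j i
    simp only [slackMatrix, mulVec_zero, vecMulVec_zero, zero_vecMulVec, sub_zero, zero_smul,
      add_zero, h1] at this
    simpa [mulVec_neg] using this
  have hX0 : X = 0 := by
    ext j k
    have : (fun j => X j k) = 0 := by
      refine eq_zero_of_mulVec_nonpos hP hB fun i => le_of_eq ?_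
      have := congrFun (hXA i) k
      simp only [mulVec, dotProduct, Pi.zero_apply] at this ⊢
      rw [← this]
      exact Finset.sum_congr rfl fun j _ => by rw [← hX.apply j k, mul_comm]
    exact congrFun this j
  subst hX0
  refine Subtype.ext (hZ.trans ?_)
  ext (i | i) (j | j) <;> rfl

theorem boundSDP_weak_duality (A : Matrix ι κ ℝ) (b : ι → ℝ) {Q : Matrix κ κ ℝ} (hQ : Q.IsSymm)
    (c : κ → ℝ) {Y : symMatrix ι} {y : ι → ℝ} {ℓ : ℝ}
    (h : (boundSDP A b Q hQ c).Feasible (Y, y, ℓ)) {x : κ → ℝ} {X : Matrix κ κ ℝ}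
    (hX : RelaxFeasible A b x X) : ℓ ≤ relaxObj Q c x X := by
  have hs : (bordered X x 1).PosSemidef := (posSemidef_bordered_one_iff x).2 hX.2.2
  let Z : symMatrix (κ ⊕ Unit) := ⟨bordered X x 1, (posSemidef_iff_isSymm_and_nonneg.1 hs).1⟩
  obtain ⟨h1, h2⟩ := (boundSDP_dualFeasible_iff A b hQ c Z).2 ⟨x, X, hX, rfl⟩
  have h3 := h1 h.2
  have h4 := h2 _ h.1
  rw [map_add, LinearMap.add_apply, symPairing_off A b hQ c (Z := Z) rfl] at h3
  have h5 : (boundSDP A b Q hQ c).obj (Y, y, ℓ) = ℓ := rfl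
  linarith

variable [DecidableEq κ]

/-- Otherwise a separating Z has positive corner t, while the direction ℓ = -1 forces t ≤ 0. -/
theorem exists_boundSDP_feasible {A : Matrix ι κ ℝ} {b : ι → ℝ}
    (hP : (polyhedron A b).Nonempty) (hB : Bornology.IsBounded (polyhedron A b))
    {Q : Matrix κ κ ℝ} (hQ : Q.IsSymm) (c : κ → ℝ) :
    ∃ Y y ℓ, (boundSDP A b Q hQ c).Feasible (Y, y, ℓ) := by
  by_contra hcon
  push Not at hcon
  obtain ⟨Z, hne, hpsd, hG, -⟩ := exists_posSemidef_separating
    (PointedCone.map (-boundMap A b) (boundCone ι)) (boundSDP A b Q hQ c).off (by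
      intro g hg hmem
      obtain ⟨v, hv, rfl⟩ := PointedCone.mem_map.1 hg
      refine hcon v.1 v.2.1 v.2.2 ⟨hv, ?_⟩
      rwa [LinearMap.neg_apply, sub_neg_eq_add] at hmem)
  have h : ∀ v ∈ boundCone ι, symPairing (κ ⊕ Unit) (boundMap A b v) Z ≤ 0 := fun v hv => by
    have := hG _ (PointedCone.mem_map.2 ⟨v, hv, rfl⟩)
    rw [LinearMap.neg_apply, map_neg, LinearMap.neg_apply] at this
    linarith
  obtain ⟨X, x, t, hX, hZ⟩ := exists_eq_bordered Z.2
  have ht := corner_pos_of_bounded hP hB hne hpsd (fun v hv _ => h v hv) hZ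
  have := h (0, 0, -1) ⟨fun _ _ => le_rfl, fun _ => le_rfl⟩
  rw [symPairing_boundMap A b _ hZ] at this
  simp at this
  linarith

theorem boundSDP_strong_duality {A : Matrix ι κ ℝ} {b : ι → ℝ}
    (hP : (polyhedron A b).Nonempty) (hB : Bornology.IsBounded (polyhedron A b))
    {Q : Matrix κ κ ℝ} (hQ : Q.IsSymm) (c : κ → ℝ) {ℓ : ℝ}
    (hℓ : ∀ x X, RelaxFeasible A b x X → ℓ < relaxObj Q c x X) :
    ∃ Y y, (boundSDP A b Q hQ c).Feasible (Y, y, ℓ) := by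
  by_contra hcon
  push Not at hcon
  have hsplit : ∀ v : symMatrix ι × (ι → ℝ) × ℝ, v = (v.1, v.2.1, 0) + (0, 0, v.2.2) := fun v => by
    simp
  obtain ⟨Z, hne, hpsd, hG, hH⟩ := exists_posSemidef_separating
    -- Intersecting with the kernel of the objective freezes ℓ, which is moved into the point to be
    -- separated.
    (PointedCone.map (-boundMap A b) (boundCone ι ⊓
      PointedCone.ofSubmodule (LinearMap.ker (boundSDP A b Q hQ c).obj)))
    ((boundSDP A b Q hQ c).off + boundMap A b (0, 0, ℓ)) (by
      intro g hg hmem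
      obtain ⟨v, ⟨hv, hv0⟩, rfl⟩ := PointedCone.mem_map.1 hg
      have hv0' : v.2.2 = 0 := hv0
      refine hcon v.1 v.2.1 ⟨hv, ?_⟩
      rw [LinearMap.neg_apply, sub_neg_eq_add, add_assoc, ← map_add] at hmem
      have e : ((0, 0, ℓ) + v : symMatrix ι × (ι → ℝ) × ℝ) = (v.1, v.2.1, ℓ) := by
        ext <;> simp [hv0']
      rwa [e] at hmem)
  have h : ∀ v ∈ boundCone ι, v.2.2 = 0 → symPairing (κ ⊕ Unit) (boundMap A b v) Z ≤ 0 :=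
    fun v hv hv0 => by
      have := hG _ (PointedCone.mem_map.2 ⟨v, ⟨hv, hv0⟩, rfl⟩)
      rw [LinearMap.neg_apply, map_neg, LinearMap.neg_apply] at this
      linarith
  obtain ⟨X, x, t, hX, hZ⟩ := exists_eq_bordered Z.2
  have ht := corner_pos_of_bounded hP hB hne hpsd h hZ
  have hE : ∀ s : ℝ, symPairing (κ ⊕ Unit) (boundMap A b (0, 0, s)) Z = -(s * t) := fun s => by
    rw [symPairing_boundMap A b _ hZ]; simp
  -- Scaling the corner to 1 makes the ℓ-part of the pairing cancel the objective exactly.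
  obtain ⟨x', X', hR, hZ'⟩ := (boundSDP_dualFeasible_iff A b hQ c (t⁻¹ • Z)).1 ⟨by
      rw [boundSDP, mem_dual_psdCone]
      exact hpsd.smul (inv_nonneg.2 ht.le), fun v hv => by
      have h1 := h (v.1, v.2.1, 0) hv rfl
      have h2 : symPairing (κ ⊕ Unit) (boundMap A b v) Z =
          symPairing (κ ⊕ Unit) (boundMap A b (v.1, v.2.1, 0)) Z - v.2.2 * t := by
        rw [hsplit v, map_add, map_add, LinearMap.add_apply, hE]
        simp [sub_eq_add_neg]
      change 0 ≤ -(v.2.2 + symPairing (κ ⊕ Unit) (boundMap A b v) (t⁻¹ • Z))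
      rw [map_smul, smul_eq_mul, h2, mul_sub]
      have h3 : t⁻¹ * (v.2.2 * t) = v.2.2 := by field_simp
      have h4 := mul_nonpos_of_nonneg_of_nonpos (inv_nonneg.2 ht.le) h1
      linarith⟩
  have h1 := hℓ x' X' hR
  rw [← symPairing_off A b hQ c hZ', map_smul, smul_eq_mul, inv_mul_eq_div, lt_div_iff₀ ht] at h1
  rw [map_add, LinearMap.add_apply, hE] at hH
  linarith

theorem exists_boundValue_eq_relaxValue {A : Matrix ι κ ℝ} {b : ι → ℝ}
    (hP : (polyhedron A b).Nonempty) (hB : Bornology.IsBounded (polyhedron A b))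
    {Q : Matrix κ κ ℝ} (hQ : Q.IsSymm) (c : κ → ℝ) :
    ∃ v : ℝ, boundValue A b Q c = v ∧ relaxValue A b Q c = v := by
  have hfeas : ∀ {ℓ : ℝ} {Y y}, (boundSDP A b Q hQ c).Feasible (Y, y, ℓ) →
      (ℓ : EReal) ≤ boundValue A b Q c := fun {ℓ Y y} h => by
    obtain ⟨α, hα⟩ := (exists_boundFeasible_iff hP hQ c ℓ).2 ⟨Y, y, h⟩
    exact le_iSup_of_le ℓ (le_iSup₂_of_le α hα le_rfl)
  have hweak : boundValue A b Q c ≤ relaxValue A b Q c := by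
    refine iSup_le fun ℓ => iSup₂_le fun α hα => le_iInf fun x => le_iInf₂ fun X hX => ?_
    obtain ⟨Y, y, h⟩ := (exists_boundFeasible_iff hP hQ c ℓ).1 ⟨α, hα⟩
    exact EReal.coe_le_coe_iff.2 (boundSDP_weak_duality A b hQ c h hX)
  have hstrong : relaxValue A b Q c ≤ boundValue A b Q c := by
    -- Only values strictly below the relaxation value are shown feasible; attainment is not
    -- claimed.
    refine EReal.ge_of_forall_gt_iff_ge.1 fun ℓ hℓ => ?_
    obtain ⟨Y, y, h⟩ := boundSDP_strong_duality hP hB hQ c (ℓ := ℓ) fun x X hX =>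
      EReal.coe_lt_coe_iff.1 (hℓ.trans_le (iInf_le_of_le x (iInf₂_le_of_le X hX le_rfl)))
    exact hfeas h
  obtain ⟨p, hp⟩ := hP
  obtain ⟨Y, y, ℓ, h⟩ := exists_boundSDP_feasible ⟨p, hp⟩ hB hQ c
  have htop : relaxValue A b Q c ≠ ⊤ := ne_top_of_le_ne_top
    (EReal.coe_ne_top (relaxObj Q c p (vecMulVec p p)))
    (iInf_le_of_le p (iInf₂_le_of_le _ (relaxFeasible_vecMulVec hp) le_rfl))
  have hbot : relaxValue A b Q c ≠ ⊥ := ne_bot_of_le_ne_bot (EReal.coe_ne_bot ℓ)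
    ((hfeas h).trans hweak)
  refine ⟨(relaxValue A b Q c).toReal, ?_, (EReal.coe_toReal htop hbot).symm⟩
  rw [EReal.coe_toReal htop hbot]
  exact hweak.antisymm hstrong

end StrongDuality

/-! ### Box constraints and RLT -/

section Box

variable {ι κ : Type*} [DecidableEq κ]

theorem boxMatrix_upper (a : Matrix ι κ ℝ) (k : κ) :
    boxMatrix a (.inl (.inl k)) = Pi.single k 1 := by
  ext j; simp [boxMatrix, Matrix.one_apply, Pi.single_apply, eq_comm]

theorem boxMatrix_lower (a : Matrix ι κ ℝ) (k : κ) :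
    boxMatrix a (.inl (.inr k)) = -Pi.single k 1 := by
  ext j; simp [boxMatrix, Matrix.one_apply, Pi.single_apply, eq_comm]

theorem boxMatrix_eq (a : Matrix ι κ ℝ) (i : ι) : boxMatrix a (.inr (.inl i)) = a i := rfl

theorem boxMatrix_neg_eq (a : Matrix ι κ ℝ) (i : ι) : boxMatrix a (.inr (.inr i)) = -a i := rfl

end Box

section Box

variable {ι κ : Type*} [Fintype κ]

theorem isBounded_boxSet (a : Matrix ι κ ℝ) (d : ι → ℝ) (l u : κ → ℝ) :
    Bornology.IsBounded (boxSet a d l u) :=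
  (Metric.isBounded_Icc l u).subset fun _ hx => ⟨hx.2.1, hx.2.2⟩

/-- The linearized product of two slacks, in terms of the rows of the system. -/
theorem slackMatrix_apply (A : Matrix ι κ ℝ) (b : ι → ℝ) (X : Matrix κ κ ℝ) (x : κ → ℝ)
    (i j : ι) : slackMatrix A b X x 1 i j =
      A i ⬝ᵥ X *ᵥ A j - b i * (A j ⬝ᵥ x) - (A i ⬝ᵥ x) * b j + b i * b j := by
  have h : (A * X * Aᵀ) i j = A i ⬝ᵥ X *ᵥ A j := by
    rw [Matrix.mul_assoc]; rfl
  simp only [slackMatrix, one_smul, Matrix.add_apply, Matrix.sub_apply, vecMulVec_apply, h, mulVec]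

variable [DecidableEq κ]

/-- For a box-constrained program the semidefinite relaxation is the Shor relaxation with partial
first-level RLT. -/
theorem relaxFeasible_box_iff {a : Matrix ι κ ℝ} {d : ι → ℝ} {l u : κ → ℝ} (hlu : l ≤ u)
    (x : κ → ℝ) (X : Matrix κ κ ℝ) :
    RelaxFeasible (boxMatrix a) (boxRhs d l u) x X ↔ SRLTFeasible a d l u x X := by
  have hbox : boxMatrix a *ᵥ x ≤ boxRhs d l u ↔ a *ᵥ x = d ∧ l ≤ x ∧ x ≤ u :=
    Set.ext_iff.1 (polyhedron_box a d l u) x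
  rw [relaxFeasible_iff, hbox]
  have hsymm : (X - vecMulVec x x).PosSemidef → X.IsSymm := fun h => by
    have := (posSemidef_iff_isSymm_and_nonneg.1 h).1.add
      (transpose_vecMulVec x x : (vecMulVec x x).IsSymm)
    rwa [sub_add_cancel] at this
  constructor
  · rintro ⟨hW, ⟨hax, hl, hu⟩, hpsd⟩
    have hX := hsymm hpsd
    have hax' : ∀ i, a i ⬝ᵥ x = d i := fun i => congrFun hax i
    simp only [slackMatrix_apply] at hW
    refine ⟨fun i => funext fun k => ?_, hax, fun j k => ?_, fun j k => ?_, fun j k => ?_, hpsd⟩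
    -- The products of u_k - x_k with the two opposite rows of an equation linearize to ±((Xa_i)_k -
    -- d_i x_k).
    · have h1 := hW (.inl (.inl k)) (.inr (.inl i))
      have h2 := hW (.inl (.inl k)) (.inr (.inr i))
      simp only [boxMatrix_upper, boxMatrix_eq, boxMatrix_neg_eq, boxRhs, Sum.elim_inl,
        Sum.elim_inr, single_one_dotProduct, neg_dotProduct, mulVec_neg, Pi.neg_apply, hax'] at h1 h2
      simp only [Pi.smul_apply, smul_eq_mul]
      linarith
    · have := hW (.inl (.inr j)) (.inl (.inr k))
      simp [boxMatrix_lower, boxRhs, mulVec_neg] at this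
      simp [vecMulVec_apply]
      linarith
    · have := hW (.inl (.inl j)) (.inl (.inr k))
      simp [boxMatrix_lower, boxMatrix_upper, boxRhs, mulVec_neg] at this
      simp [vecMulVec_apply]
      linarith
    · have := hW (.inl (.inl j)) (.inl (.inl k))
      simp [boxMatrix_upper, boxRhs] at this
      simp [vecMulVec_apply]
      linarith
  · rintro ⟨hXa, hax, h1, h2, h3, hpsd⟩
    have hX := hsymm hpsd
    have hax' : ∀ i, a i ⬝ᵥ x = d i := fun i => congrFun hax i
    -- The diagonal RLT constraint combined with X_kk ≥ x_k². Since l ≤ u, a nonnegative product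
    -- puts x_k between l_k and u_k.
    have hprod : ∀ k, 0 ≤ (u k - x k) * (x k - l k) := fun k => by
      have e1 := h2 k k
      have e2 := hpsd.diag_nonneg (i := k)
      simp only [Matrix.sub_apply, Matrix.add_apply, vecMulVec_apply] at e1 e2
      linarith
    have haX : ∀ i k, a i ⬝ᵥ X.col k = d i * x k := fun i k => by
      rw [← mulVec_single_one, dotProduct_mulVec, ← mulVec_transpose, hX.eq, hXa]
      simp
    refine ⟨?_, ⟨hax, fun k => ?_, fun k => ?_⟩, hpsd⟩
    · simp only [slackMatrix_apply]
      simp only [Matrix.sub_apply, Matrix.add_apply, vecMulVec_apply] at h1 h2 h3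
      rintro ((j | j) | (j | j)) ((k | k) | (k | k)) <;>
        simp only [boxMatrix_upper, boxMatrix_lower, boxMatrix_eq, boxMatrix_neg_eq, boxRhs,
          Sum.elim_inl, Sum.elim_inr, single_one_dotProduct, neg_dotProduct, mulVec_neg,
          dotProduct_neg, dotProduct_smul, Pi.neg_apply, hax', haX, hXa, smul_eq_mul,
          mulVec_single_one, Matrix.col_apply]
      · linarith [h3 j k]
      · linarith [h2 j k]
      · linarith
      · linarith
      -- The lower-upper product is the transpose of the upper-lower one, hence symmetry of X.
      · linarith [h2 k j, hX.apply j k]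
      · linarith [h1 j k]
      all_goals linarith
    · have := hprod k
      have := hlu k
      by_contra! hlt
      nlinarith
    · have := hprod k
      have := hlu k
      by_contra! hlt
      nlinarith

end Box

theorem mainTheorem7 {ι κ : Type*} [Fintype ι] [Fintype κ] [DecidableEq κ]
    (Q : Matrix κ κ ℝ) (hQ : Q.IsSymm) (c : κ → ℝ) :
    -- the program `min xᵀ Q x + 2 cᵀ x` s.t. `A x ≤ b`, with nonempty and bounded feasible set
    (∀ (A : Matrix ι κ ℝ) (b : ι → ℝ), (polyhedron A b).Nonempty →
      Bornology.IsBounded (polyhedron A b) →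
      -- the bound is the conic program `boundSDP`
      (∀ ℓ : ℝ, (∃ α, BoundFeasible A b Q c ℓ α) ↔
        ∃ Y y, (boundSDP A b Q hQ c).Feasible (Y, y, ℓ)) ∧
      -- the conic dual of it is the semidefinite relaxation, with the same objective function
      (∀ Z, (boundSDP A b Q hQ c).DualFeasible (symPairing (κ ⊕ Unit)) Z ↔
        ∃ x X, RelaxFeasible A b x X ∧ (Z : Matrix (κ ⊕ Unit) (κ ⊕ Unit) ℝ) = bordered X x 1) ∧
      (∀ (Z : symMatrix (κ ⊕ Unit)) x X, (Z : Matrix (κ ⊕ Unit) (κ ⊕ Unit) ℝ) = bordered X x 1 →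
        (boundSDP A b Q hQ c).dualObj (symPairing (κ ⊕ Unit)) Z = relaxObj Q c x X) ∧
      -- it is a relaxation of the quadratic program
      (∀ x ∈ polyhedron A b, RelaxFeasible A b x (Matrix.vecMulVec x x) ∧
        relaxObj Q c x (Matrix.vecMulVec x x) = quadFun Q c x) ∧
      -- strong duality, with a finite common value
      ∃ v : ℝ, boundValue A b Q c = v ∧ relaxValue A b Q c = v) ∧
    -- the program `min xᵀ Q x + 2 cᵀ x` s.t. `a x = d`, `l ≤ x ≤ u`
    (∀ (a : Matrix ι κ ℝ) (d : ι → ℝ) (l u : κ → ℝ), (boxSet a d l u).Nonempty →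
      (∀ x X, RelaxFeasible (boxMatrix a) (boxRhs d l u) x X ↔ SRLTFeasible a d l u x X) ∧
      (∀ Z, (boundSDP (boxMatrix a) (boxRhs d l u) Q hQ c).DualFeasible
          (symPairing (κ ⊕ Unit)) Z ↔
        ∃ x X, SRLTFeasible a d l u x X ∧
          (Z : Matrix (κ ⊕ Unit) (κ ⊕ Unit) ℝ) = bordered X x 1) ∧
      ∃ v : ℝ, boundValue (boxMatrix a) (boxRhs d l u) Q c = v ∧ srltValue a d l u Q c = v) := by
  refine ⟨fun A b hP hB => ⟨exists_boundFeasible_iff hP hQ c, boundSDP_dualFeasible_iff A b hQ c,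
    fun Z x X hZ => symPairing_off A b hQ c hZ,
    fun x hx => ⟨relaxFeasible_vecMulVec hx, relaxObj_vecMulVec Q c x⟩,
    exists_boundValue_eq_relaxValue hP hB hQ c⟩, fun a d l u hne => ?_⟩
  have hiff : ∀ x X, RelaxFeasible (boxMatrix a) (boxRhs d l u) x X ↔ SRLTFeasible a d l u x X :=
    relaxFeasible_box_iff (hne.elim fun _ hx => hx.2.1.trans hx.2.2)
  refine ⟨hiff, fun Z => ?_, ?_⟩
  · simp only [boundSDP_dualFeasible_iff, hiff]
  · rw [← polyhedron_box] at hne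
    obtain ⟨v, h1, h2⟩ := exists_boundValue_eq_relaxValue hne
      (polyhedron_box a d l u ▸ isBounded_boxSet a d l u) hQ c
    refine ⟨v, h1, ?_⟩
    simpa only [srltValue, relaxValue, hiff] using h2
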